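/- Let $\sigma:\Sigma^+\to\Sigma^+$ be a one-sided topologically mixing subshift of finite type over a finite alphabet. Fix $0<\lambda<1$ and let $d(x,y)=\lambda^{n}$ with $n=\min\{k\ge 0 : x_k\neq y_k\}$ for $x\ne y$, and $d(x,x)=0$. For $\gamma>0$ let $C^\gamma(\Sigma^+,\mathbb R)$ be the space of $\gamma$-Hölder functions $A:\Sigma^+\to\mathbb R$, with the norm $$\|A\|_\gamma=\sup_{0<d(x,y)\le 1}\frac{|A(x)-A(y)|}{d(x,y)^\gamma}+\sup_{x}|A(x)|,$$ and let $C^\gamma_0(\Sigma^+,\mathbb R)$ be the subset of those $A$ with topological pressure $P(A)=0$. Let $0<\alpha\le 1$ and let $C^{\alpha+}_0(\Sigma^+,\mathbb R)$ be the closure of $\bigcup_{\gamma>\alpha}C^\gamma_0(\Sigma^+,\mathbb R)$ in $C^\alpha(\Sigma^+,\mathbb R)$ for the norm $\|\cdot\|_\alpha$, with the induced topology. A maximizing measure for $A$ is a $\sigma$-invariant Borel probability measure that maximizes $\nu\mapsto\int A\,d\nu$ among all $\sigma$-invariant Borel probability measures. For a point $p$ with $\sigma^N p=p$, $N\ge 1$,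 let $\nu_p=\frac1N\sum_{k=0}^{N-1}\delta_{\sigma^k p}$. **Theorem B.** Let $\mathcal G_2$ be the set of all $A\in C^{\alpha+}_0(\Sigma^+,\mathbb R)$ for which there are a periodic point $p\in\Sigma^+$ and a neighbourhood $\mathcal U$ of $A$ in $C^{\alpha+}_0(\Sigma^+,\mathbb R)$ such that, for every $B\in\mathcal U$, $\nu_p$ is the unique maximizing measure for $B$. Then $\mathcal G_2$ is open and dense in $C^{\alpha+}_0(\Sigma^+,\mathbb R)$. -/

import Mathlib

open MeasureTheory Filter Topology SymbolicDynamics.FullShift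

noncomputable section

namespace HolderShift

/-! ### One-sided subshifts of finite type -/

variable {S : Type*} [TopologicalSpace S]

/-- A one-sided subshift (a closed, shift-invariant set of sequences `x₀ x₁ x₂ …`) is of finite
type if it is given by finitely many forbidden finite patterns. -/
def IsFiniteType [Inhabited S] (Y : Subshift S ℕ) : Prop :=
  ∃ F : Set (Pattern S ℕ), F.Finite ∧ Y.carrier = forbidden F

/-- The shift map `(x₀, x₁, x₂, …) ↦ (x₁, x₂, x₃, …)` on a one-sided subshift. -/
def sigma (Y : Subshift S ℕ) : Y.carrier → Y.carrier :=
  (Y.mapsTo 1).restrict (shift (1 : ℕ)) Y.carrier Y.carrier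

/-- Topological mixing: for all nonempty open sets `U`, `V`, one has `f^n(U) ∩ V ≠ ∅` for all
large `n`. -/
def TopologicallyMixing {X : Type*} [TopologicalSpace X] (f : X → X) : Prop :=
  ∀ U V : Set X, IsOpen U → IsOpen V → U.Nonempty → V.Nonempty →
    ∃ N : ℕ, ∀ n ≥ N, (f^[n] '' U ∩ V).Nonempty

open Classical in
/-- The distance `d(x, y) = lam ^ n`, where `n` is the first index with `x n ≠ y n`, and
`d(x, x) = 0`. -/
def symDist {Y : Subshift S ℕ} (lam : ℝ) (x y : Y.carrier) : ℝ :=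
  if x = y then 0 else lam ^ PiNat.firstDiff (E := fun _ => S) x.1 y.1

theorem symDist_nonneg {Y : Subshift S ℕ} {lam : ℝ} (h0 : 0 < lam) (x y : Y.carrier) :
    0 ≤ symDist lam x y := by
  unfold symDist
  split_ifs <;> positivity

theorem symDist_le_one {Y : Subshift S ℕ} {lam : ℝ} (h0 : 0 < lam) (h1 : lam < 1)
    (x y : Y.carrier) : symDist lam x y ≤ 1 := by
  unfold symDist
  split_ifs
  · exact zero_le_one
  · exact pow_le_one₀ h0.le h1.le

/-! ### Hölder functions with the Hölder norm -/

/-- The bounded `α`-Hölder functions on a subshift, with respect to `symDist lam`. For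
`0 < lam < 1` and `0 ≤ α` boundedness is automatic, see `mem_holderSubmodule_iff`. -/
def holderSubmodule (Y : Subshift S ℕ) (lam α : ℝ) : Submodule ℝ (Y.carrier → ℝ) where
  carrier := {A | (∃ M : ℝ, ∀ x, |A x| ≤ M) ∧
    ∃ C : ℝ, ∀ x y, |A x - A y| ≤ C * symDist lam x y ^ α}
  zero_mem' := ⟨⟨0, by simp⟩, ⟨0, by simp⟩⟩
  add_mem' := by
    rintro A B ⟨⟨M, hM⟩, ⟨C, hC⟩⟩ ⟨⟨M', hM'⟩, ⟨C', hC'⟩⟩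
    refine ⟨⟨M + M', fun x => (abs_add_le _ _).trans (add_le_add (hM x) (hM' x))⟩,
      ⟨C + C', fun x y => ?_⟩⟩
    calc |(A + B) x - (A + B) y| = |(A x - A y) + (B x - B y)| := by
          congr 1; simp only [Pi.add_apply]; ring
      _ ≤ |A x - A y| + |B x - B y| := abs_add_le _ _
      _ ≤ (C + C') * symDist lam x y ^ α := by linarith [hC x y, hC' x y]
  smul_mem' := by
    rintro c A ⟨⟨M, hM⟩, ⟨C, hC⟩⟩
    refine ⟨⟨|c| * M, fun x => ?_⟩, ⟨|c| * C, fun x y => ?_⟩⟩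
    · simpa [abs_mul] using mul_le_mul_of_nonneg_left (hM x) (abs_nonneg c)
    · simpa [abs_mul, ← mul_sub, mul_assoc] using
        mul_le_mul_of_nonneg_left (hC x y) (abs_nonneg c)

theorem mem_holderSubmodule_iff {Y : Subshift S ℕ} {lam α : ℝ} (h0 : 0 < lam) (h1 : lam < 1)
    (hα : 0 ≤ α) (A : Y.carrier → ℝ) :
    A ∈ holderSubmodule Y lam α ↔
      ∃ C : ℝ, ∀ x y, |A x - A y| ≤ C * symDist lam x y ^ α := by
  refine ⟨fun h => h.2, fun h => ⟨?_, h⟩⟩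
  obtain ⟨C, hC⟩ := h
  rcases isEmpty_or_nonempty Y.carrier with he | ⟨⟨y⟩⟩
  · exact ⟨0, fun x => he.elim x⟩
  · refine ⟨|C| + |A y|, fun x => ?_⟩
    have hd : symDist lam x y ^ α ≤ 1 :=
      Real.rpow_le_one (symDist_nonneg h0 x y) (symDist_le_one h0 h1 x y) hα
    have hd0 : 0 ≤ symDist lam x y ^ α := Real.rpow_nonneg (symDist_nonneg h0 x y) _
    have h2 : C * symDist lam x y ^ α ≤ |C| := by
      calc C * symDist lam x y ^ α ≤ |C| * symDist lam x y ^ α :=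
            mul_le_mul_of_nonneg_right (le_abs_self C) hd0
        _ ≤ |C| := mul_le_of_le_one_right (abs_nonneg C) hd
    have h3 : |A x| ≤ |A x - A y| + |A y| := by
      simpa using abs_add_le (A x - A y) (A y)
    linarith [hC x y]

/-- The space `C^α` of `α`-Hölder functions, carrying the `α`-Hölder norm defined below (and not
the topology of pointwise convergence). -/
def HolderSpace (Y : Subshift S ℕ) (lam α : ℝ) : Type _ := holderSubmodule Y lam α

instance (Y : Subshift S ℕ) (lam α : ℝ) : AddCommGroup (HolderSpace Y lam α) :=
  inferInstanceAs (AddCommGroup (holderSubmodule Y lam α))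

instance (Y : Subshift S ℕ) (lam α : ℝ) : CoeFun (HolderSpace Y lam α) fun _ => Y.carrier → ℝ :=
  ⟨fun A => A.1⟩

/-- The supremum norm. -/
def supNorm {X : Type*} (A : X → ℝ) : ℝ := ⨆ x, |A x|

/-- The Hölder constant `sup {|A x - A y| / d(x, y) ^ α : 0 < d(x, y) ≤ 1}`. -/
def holdConst {Y : Subshift S ℕ} (lam α : ℝ) (A : Y.carrier → ℝ) : ℝ :=
  ⨆ p : {p : Y.carrier × Y.carrier // 0 < symDist lam p.1 p.2 ∧ symDist lam p.1 p.2 ≤ 1},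
    |A p.1.1 - A p.1.2| / symDist lam p.1.1 p.1.2 ^ α

theorem bddAbove_abs {Y : Subshift S ℕ} {lam α : ℝ} (A : HolderSpace Y lam α) :
    BddAbove (Set.range fun x => |A x|) := by
  obtain ⟨M, hM⟩ := A.2.1
  exact ⟨M, by rintro _ ⟨x, rfl⟩; exact hM x⟩

theorem bddAbove_hold {Y : Subshift S ℕ} {lam α : ℝ} (A : HolderSpace Y lam α) :
    BddAbove (Set.range fun p : {p : Y.carrier × Y.carrier //
      0 < symDist lam p.1 p.2 ∧ symDist lam p.1 p.2 ≤ 1} =>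
        |A p.1.1 - A p.1.2| / symDist lam p.1.1 p.1.2 ^ α) := by
  obtain ⟨C, hC⟩ := A.2.2
  refine ⟨C, ?_⟩
  rintro _ ⟨p, rfl⟩
  exact (div_le_iff₀ (Real.rpow_pos_of_pos p.2.1 α)).2 (hC _ _)

theorem supNorm_nonneg {X : Type*} (A : X → ℝ) : 0 ≤ supNorm A :=
  Real.iSup_nonneg fun _ => abs_nonneg _

theorem holdConst_nonneg {Y : Subshift S ℕ} (lam α : ℝ) (A : Y.carrier → ℝ) :
    0 ≤ holdConst lam α A :=
  Real.iSup_nonneg fun p => div_nonneg (abs_nonneg _) (Real.rpow_nonneg p.2.1.le _)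

/-- The `α`-Hölder norm `‖A‖_α = Hold_α(A) + ‖A‖_0`, as a norm on `C^α`. -/
def holderNorm (Y : Subshift S ℕ) (lam α : ℝ) : AddGroupNorm (HolderSpace Y lam α) where
  toFun A := holdConst lam α A + supNorm A
  map_zero' := by
    have h : ((0 : HolderSpace Y lam α) : Y.carrier → ℝ) = 0 := rfl
    simp [holdConst, supNorm, h]
  add_le' A B := by
    have h : ((A + B : HolderSpace Y lam α) : Y.carrier → ℝ) = fun x => A x + B x := rfl
    have hs : supNorm (A + B : HolderSpace Y lam α) ≤ supNorm A + supNorm B := by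
      refine Real.iSup_le (fun x => ?_) (add_nonneg (supNorm_nonneg _) (supNorm_nonneg _))
      rw [h]
      exact (abs_add_le _ _).trans
        (add_le_add (le_ciSup (bddAbove_abs A) x) (le_ciSup (bddAbove_abs B) x))
    have hh : holdConst lam α (A + B : HolderSpace Y lam α) ≤
        holdConst lam α A + holdConst lam α B := by
      refine Real.iSup_le (fun p => ?_)
        (add_nonneg (holdConst_nonneg _ _ _) (holdConst_nonneg _ _ _))
      refine le_trans ?_
        (add_le_add (le_ciSup (bddAbove_hold A) p) (le_ciSup (bddAbove_hold B) p))
      rw [h, ← add_div]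
      refine div_le_div_of_nonneg_right ?_ (Real.rpow_nonneg p.2.1.le _)
      calc |(A p.1.1 + B p.1.1) - (A p.1.2 + B p.1.2)|
          = |(A p.1.1 - A p.1.2) + (B p.1.1 - B p.1.2)| := by congr 1; ring
        _ ≤ _ := abs_add_le _ _
    linarith
  neg' A := by
    have h : ((-A : HolderSpace Y lam α) : Y.carrier → ℝ) = fun x => -A x := rfl
    have hh : holdConst lam α (-A : HolderSpace Y lam α) = holdConst lam α A := by
      unfold holdConst
      refine iSup_congr fun p => ?_
      rw [h]
      congr 1
      rw [← abs_neg]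
      congr 1
      ring
    have hs : supNorm (-A : HolderSpace Y lam α) = supNorm A := by
      simp [supNorm, h]
    rw [hh, hs]
  eq_zero_of_map_eq_zero' A hA := by
    have h1 := supNorm_nonneg (A : Y.carrier → ℝ)
    have h2 := holdConst_nonneg lam α (A : Y.carrier → ℝ)
    have h3 : supNorm (A : Y.carrier → ℝ) = 0 := by linarith
    refine Subtype.ext (funext fun x => ?_)
    have h4 : |A x| ≤ supNorm (A : Y.carrier → ℝ) := le_ciSup (bddAbove_abs A) x
    exact abs_eq_zero.1 (le_antisymm (h4.trans h3.le) (abs_nonneg _))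

instance (Y : Subshift S ℕ) (lam α : ℝ) : NormedAddCommGroup (HolderSpace Y lam α) :=
  (holderNorm Y lam α).toNormedAddCommGroup

/-! ### Topological pressure -/

/-- A finite set `E` is `(n, ε)`-separated if any two distinct points of `E` have
`max_{0 ≤ i < n} d(σ^i x, σ^i y) > ε`. -/
def IsSeparated {Y : Subshift S ℕ} (lam : ℝ) (n : ℕ) (ε : ℝ) (E : Finset Y.carrier) : Prop :=
  ∀ x ∈ E, ∀ y ∈ E, x ≠ y → ∃ i < n, ε < symDist lam ((sigma Y)^[i] x) ((sigma Y)^[i] y)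

/-- `sup_E ∑_{x ∈ E} exp (A(x) + A(σ x) + ⋯ + A(σ^{n-1} x))`, over all `(n, ε)`-separated sets. -/
def partitionSup {Y : Subshift S ℕ} (lam : ℝ) (A : Y.carrier → ℝ) (n : ℕ) (ε : ℝ) : ENNReal :=
  ⨆ (E : Finset Y.carrier) (_ : IsSeparated lam n ε E),
    ∑ x ∈ E, ENNReal.ofReal (Real.exp (birkhoffSum (sigma Y) A n x))

/-- The topological pressure
`P(A) = lim_{ε → 0} limsup_{n → ∞} (1/n) log sup_E ∑_{x ∈ E} exp (∑_{i < n} A(σ^i x))`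
(`E` runs over the `(n, ε)`-separated sets), in `[-∞, ∞]`. The limit in `ε` is a supremum by
monotonicity. -/
def pressure {Y : Subshift S ℕ} (lam : ℝ) (A : Y.carrier → ℝ) : EReal :=
  ⨆ (ε : ℝ) (_ : 0 < ε),
    limsup (fun n : ℕ => ENNReal.log (partitionSup lam A n ε) / (n : EReal)) atTop

/-- The closure, in the `α`-Hölder topology, of the set of functions which have zero topological
pressure and which are `γ`-Hölder for some `γ > α`. -/
def holderPlusZero (Y : Subshift S ℕ) (lam α : ℝ) : Set (HolderSpace Y lam α) :=
  closure {A | ∃ γ > α, (A : Y.carrier → ℝ) ∈ holderSubmodule Y lam γ ∧ pressure lam A = 0}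

/-! ### Maximizing measures -/

variable [MeasurableSpace S]

/-- `μ` is a shift-invariant Borel probability measure. -/
def IsInvariantProb {Y : Subshift S ℕ} (μ : Measure Y.carrier) : Prop :=
  IsProbabilityMeasure μ ∧ MeasurePreserving (sigma Y) μ μ

/-- `μ` is a maximizing measure for `A`. -/
def IsMaximizing {Y : Subshift S ℕ} (A : Y.carrier → ℝ) (μ : Measure Y.carrier) : Prop :=
  IsInvariantProb μ ∧ ∀ ν : Measure Y.carrier, IsInvariantProb ν → ∫ x, A x ∂ν ≤ ∫ x, A x ∂μ

/-- For a point `p` with `σ^N p = p`, `N ≥ 1`, the measure `(1/N) ∑_{k < N} δ_{σ^k p}`. -/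
def orbitMeasure {Y : Subshift S ℕ} (p : Y.carrier) (N : ℕ) : Measure Y.carrier :=
  (N : ENNReal)⁻¹ • ∑ k ∈ Finset.range N, Measure.dirac ((sigma Y)^[k] p)

/-- The set of `A` in `holderPlusZero` such that, for some periodic point `p` and some
neighbourhood `U` of `A` in `holderPlusZero`, the measure on the orbit of `p` is the unique
maximizing measure of every `B ∈ U`. -/
def periodicLocked (Y : Subshift S ℕ) (lam α : ℝ) : Set (holderPlusZero Y lam α) :=
  {A | ∃ (p : Y.carrier) (N : ℕ), 0 < N ∧ (sigma Y)^[N] p = p ∧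
    ∃ U ∈ 𝓝 A, ∀ B ∈ U, ∀ μ : Measure Y.carrier,
      IsMaximizing (B.1 : Y.carrier → ℝ) μ ↔ μ = orbitMeasure p N}

end HolderShift

end

noncomputable section

namespace HolderShift

variable {S : Type*} [TopologicalSpace S] {Y : Subshift S ℕ}

/-! ### Words of points of a subshift -/

/-! Openness is immediate, since a locking neighbourhood contains an open one. For density, first
move to a zero-pressure `γ`-Hölder function with `γ > α`, then to a locally constant one: the
surplus exponent makes cylinder approximation converge in the `α`-norm (`exists_isLocal_approx`).

For a function of `k + 1` letters on a subshift of memory `k`, maximizing the mean is a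
maximal-mean-cycle problem on the finite graph whose vertices are the words of length `k`. A simple
cycle attains the maximum (`HasMemory.exists_maximal_cycle`), and cutting out loops bounds all
Birkhoff sums by `n` times that mean plus a constant (`HasMemory.exists_birkhoffSum_le`). Now
subtract `ε f`, where `f` is the indicator of the points whose first `k + 1` letters are not read on
the cycle.

The result is locked. Between two visits to `{f = 1}` an orbit must shadow the cycle, because its
`k`-words are distinct. A perturbation `h` of small Hölder norm therefore exceeds its mean along the
cycle by at most a small multiple of the number of visits plus one (`birkhoffSum_le_of_small`),
which half of the penalty absorbs. Integrating, every invariant `μ` satisfies `∫ B ≤ β - (ε / 2) ∫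
f`, with `β` the mean of the perturbed function `B` on the cycle. Equality with `β` forces `f = 0`
almost everywhere along orbits, so `μ` lives on the cycle.

Finally, pressure is 1-Lipschitz in the supremum norm and commutes with adding constants, so a small
constant restores zero pressure without affecting maximizing measures. -/

theorem sigma_iterate_apply (n : ℕ) (x : Y.carrier) (i : ℕ) :
    ((sigma Y)^[n] x).1 i = x.1 (n + i) := by
  induction n generalizing x i with
  | zero => simp
  | succ n ih =>
    rw [Function.iterate_succ_apply, ih]
    exact congrArg x.1 (by omega : 1 + (n + i) = n + 1 + i)

/-- `x` and `y` have the same first `n` letters. -/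
def Agree (n : ℕ) (x y : Y.carrier) : Prop := ∀ i < n, x.1 i = y.1 i

theorem Agree.symm {n : ℕ} {x y : Y.carrier} (h : Agree n x y) : Agree n y x :=
  fun i hi => (h i hi).symm

theorem Agree.trans {n : ℕ} {x y z : Y.carrier} (h : Agree n x y) (h' : Agree n y z) :
    Agree n x z :=
  fun i hi => (h i hi).trans (h' i hi)

theorem Agree.mono {m n : ℕ} (hmn : m ≤ n) {x y : Y.carrier} (h : Agree n x y) : Agree m x y :=
  fun i hi => h i (hi.trans_le hmn)

theorem Agree.iterate {m n : ℕ} {x y : Y.carrier} (h : Agree (m + n) x y) :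
    Agree n ((sigma Y)^[m] x) ((sigma Y)^[m] y) := fun i hi => by
  rw [sigma_iterate_apply, sigma_iterate_apply]
  exact h _ (by omega)

theorem symDist_le_of_agree {lam : ℝ} (h0 : 0 < lam) (h1 : lam < 1) {n : ℕ} {x y : Y.carrier}
    (h : Agree n x y) : symDist lam x y ≤ lam ^ n := by
  unfold symDist
  split_ifs with hxy
  · positivity
  · refine pow_le_pow_of_le_one h0.le h1.le ?_
    by_contra! hlt
    exact PiNat.apply_firstDiff_ne (fun h => hxy (Subtype.ext h)) (h _ hlt)

theorem le_symDist_of_not_agree {lam : ℝ} (h0 : 0 < lam) (h1 : lam < 1) {n : ℕ}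
    {x y : Y.carrier} (h : ¬ Agree (n + 1) x y) : lam ^ n ≤ symDist lam x y := by
  unfold symDist
  split_ifs with hxy
  · exact absurd (fun i _ => by rw [hxy]) h
  · refine pow_le_pow_of_le_one h0.le h1.le ?_
    by_contra! hlt
    exact h fun i hi => PiNat.apply_eq_of_lt_firstDiff (by omega)

/-- Membership in `Y` is decided by the words of length `k + 1`. -/
def HasMemory (Y : Subshift S ℕ) (k : ℕ) : Prop :=
  ∀ z : ℕ → S, (∀ t, ∃ y : Y.carrier, ∀ s ≤ k, z (t + s) = y.1 s) → z ∈ Y.carrier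

/-- Finitely many finite supports lie in one window `[0, k₀]`, so a forbidden pattern occurring at
`t` would already occur in the point of `Y` that supplies the letters of the window at `t`. -/
theorem IsFiniteType.exists_hasMemory [Inhabited S] (hY : IsFiniteType Y) :
    ∃ k₀, ∀ k ≥ k₀, HasMemory Y k := by
  obtain ⟨F, hF, hYF⟩ := hY
  have hbound : ∃ k₀ : ℕ, ∀ P ∈ F, ∀ s ∈ P.support, s ≤ k₀ := by
    refine ⟨hF.toFinset.sup fun P => P.support.sup id, fun P hP s hs => ?_⟩
    exact (Finset.le_sup (f := id) hs).trans
      (Finset.le_sup (f := fun P : Pattern S ℕ => P.support.sup id) (hF.mem_toFinset.2 hP))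
  obtain ⟨k₀, hk₀⟩ := hbound
  refine ⟨k₀, fun k hk z hz => ?_⟩
  rw [hYF]
  intro P hP t hocc
  obtain ⟨y, hy⟩ := hz t
  have hyF : y.1 ∈ forbidden F := hYF ▸ y.2
  refine hyF P hP 0 fun s hs => ?_
  rw [zero_add, ← hy s ((hk₀ P hP s hs).trans hk)]
  exact hocc s hs

/-- A word of length `N` followed by its own first `k` letters can be repeated periodically. -/
theorem HasMemory.exists_loop {k : ℕ} (hk : HasMemory Y k) (x : Y.carrier) {N : ℕ} (hN : 0 < N)
    (h : Agree k x ((sigma Y)^[N] x)) :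
    ∃ p : Y.carrier, (sigma Y)^[N] p = p ∧ Agree (N + k) p x := by
  have hper : ∀ u < N + k, x.1 (u % N) = x.1 u := by
    intro u
    induction u using Nat.strong_induction_on with
    | _ u ih =>
      intro hu
      rcases lt_or_ge u N with hlt | hge
      · rw [Nat.mod_eq_of_lt hlt]
      · rw [Nat.mod_eq_sub_mod hge, ih (u - N) (by omega) (by omega), h (u - N) (by omega),
          sigma_iterate_apply]
        exact congrArg x.1 (by omega : N + (u - N) = u)
  have hmem : (fun u => x.1 (u % N)) ∈ Y.carrier := by
    -- The window of the periodic sequence at `t` reads positions `t % N` to `t % N + k`, all below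
    -- `N + k`, where `x` agrees with its periodic continuation.
    refine hk _ fun t => ⟨(sigma Y)^[t % N] x, fun s hs => ?_⟩
    have ht := Nat.mod_lt t hN
    rw [sigma_iterate_apply, ← hper (t % N + s) (by omega), Nat.mod_add_mod]
  refine ⟨⟨_, hmem⟩, Subtype.ext (funext fun u => ?_), hper⟩
  rw [sigma_iterate_apply]
  simp

/-- A loop can be cut out of a sequence. -/
theorem HasMemory.exists_splice {k : ℕ} (hk : HasMemory Y k) (x : Y.carrier) (i N : ℕ)
    (h : Agree k ((sigma Y)^[i] x) ((sigma Y)^[i + N] x)) :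
    ∃ y : Y.carrier, Agree (i + k) y x ∧ (sigma Y)^[i] y = (sigma Y)^[i + N] x := by
  set z : ℕ → S := fun u => if u < i then x.1 u else x.1 (u + N) with hz
  have hagree : ∀ u < i + k, z u = x.1 u := by
    intro u hu
    by_cases hui : u < i
    · simp [hz, hui]
    · have := h (u - i) (by omega)
      rw [sigma_iterate_apply, sigma_iterate_apply] at this
      simp only [hz, hui, if_false]
      convert this.symm using 2 <;> omega
  have hmem : z ∈ Y.carrier := by
    refine hk z fun t => ?_
    by_cases ht : t < i
    · exact ⟨(sigma Y)^[t] x, fun s hs => by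
        rw [sigma_iterate_apply, hagree _ (by omega)]⟩
    · refine ⟨(sigma Y)^[t + N] x, fun s hs => ?_⟩
      have hts : ¬ t + s < i := by omega
      rw [sigma_iterate_apply]
      simp only [hz, hts, if_false]
      exact congrArg x.1 (by omega)
  refine ⟨⟨z, hmem⟩, hagree, Subtype.ext (funext fun u => ?_)⟩
  rw [sigma_iterate_apply, sigma_iterate_apply]
  have hu : ¬ i + u < i := by omega
  simp only [hz, hu, if_false]
  exact congrArg x.1 (by omega)

/-- `A x` depends on the first `k + 1` letters of `x` only. -/
def IsLocal (k : ℕ) (A : Y.carrier → ℝ) : Prop := ∀ x y, Agree (k + 1) x y → A x = A y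

/-- The last of the `n` terms starts at position `n - 1` and reads up to `n - 1 + k`. -/
theorem IsLocal.birkhoffSum_eq {k : ℕ} {A : Y.carrier → ℝ} (hA : IsLocal k A) {n : ℕ}
    {x y : Y.carrier} (h : Agree (n + k) x y) :
    birkhoffSum (sigma Y) A n x = birkhoffSum (sigma Y) A n y := by
  refine Finset.sum_congr rfl fun i hi => hA _ _ (Agree.iterate (h.mono ?_))
  have := Finset.mem_range.1 hi
  omega

theorem IsLocal.exists_bound [Finite S] {k : ℕ} {A : Y.carrier → ℝ} (hA : IsLocal k A) :
    ∃ M, 0 ≤ M ∧ ∀ x, |A x| ≤ M := by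
  have hfin : (Set.range fun x => |A x|).Finite := by
    let w : Y.carrier → (Fin (k + 1) → S) := fun x i => x.1 i
    have hw : Function.FactorsThrough (fun x => |A x|) w := fun x y hxy => by
      have : A x = A y := hA x y fun i hi => congrFun hxy ⟨i, hi⟩
      simp only [this]
    rw [← hw.extend_comp fun _ => 0]
    exact (Set.finite_range _).subset (Set.range_comp_subset_range _ _)
  obtain ⟨M, hM⟩ := hfin.bddAbove
  exact ⟨max M 0, le_max_right _ _, fun x => (hM ⟨x, rfl⟩).trans (le_max_left _ _)⟩

theorem abs_birkhoffSum_le {X : Type*} (T : X → X) {A : X → ℝ} {M : ℝ} (hM : ∀ x, |A x| ≤ M)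
    (n : ℕ) (x : X) : |birkhoffSum T A n x| ≤ n * M := by
  refine (Finset.abs_sum_le_sum_abs _ _).trans ?_
  simpa using Finset.sum_le_card_nsmul (Finset.range n) _ M fun i _ => hM (T^[i] x)

theorem birkhoffSum_iterate_of_periodic {X : Type*} {T : X → X} {N : ℕ} {p : X}
    (hp : T^[N] p = p) (A : X → ℝ) (i : ℕ) :
    birkhoffSum T A N (T^[i] p) = birkhoffSum T A N p := by
  have h1 := birkhoffSum_add T A i N p
  rw [add_comm, birkhoffSum_add T A N i p, hp] at h1
  linarith

/-- Pigeonhole on one more starting time than there are words of length `k`. -/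
theorem exists_agree_iterate [Finite S] (k : ℕ) (x : Y.carrier) :
    ∃ i j, i < j ∧ j ≤ Nat.card (Fin k → S) ∧
      Agree k ((sigma Y)^[i] x) ((sigma Y)^[j] x) := by
  have := Fintype.ofFinite (Fin k → S)
  obtain ⟨a, b, hab, h⟩ := Fintype.exists_ne_map_eq_of_card_lt
    (fun (i : Fin (Nat.card (Fin k → S) + 1)) (s : Fin k) => ((sigma Y)^[(i : ℕ)] x).1 s)
    (by simp [Nat.card_eq_fintype_card])
  wlog hlt : a < b generalizing a b
  · exact this b a hab.symm h.symm (lt_of_le_of_ne (not_lt.1 hlt) hab.symm)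
  exact ⟨a, b, hlt, by omega, fun s hs => congrFun h ⟨s, hs⟩⟩

theorem finite_periodic [Finite S] {N : ℕ} (hN : 0 < N) :
    {p : Y.carrier | (sigma Y)^[N] p = p}.Finite := by
  refine Set.Finite.of_injOn (f := fun (p : Y.carrier) (i : Fin N) => p.1 i) (t := Set.univ)
    (fun _ _ => Set.mem_univ _) (fun p hp q hq h => Subtype.ext (funext fun u => ?_))
    Set.finite_univ
  have hmod : ∀ r : Y.carrier, (sigma Y)^[N] r = r → r.1 u = r.1 (u % N) := by
    intro r hr
    have h1 : (sigma Y)^[N * (u / N)] r = r :=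
      Function.IsPeriodicPt.mul_const (f := sigma Y) (x := r) (m := N) hr (u / N)
    conv_rhs => rw [← h1, sigma_iterate_apply, Nat.div_add_mod]
  rw [hmod p hp, hmod q hq]
  exact congrFun h ⟨u % N, Nat.mod_lt u hN⟩

/-! ### Cycles of maximal mean -/

/-- Among the periodic orbits whose period is at most the number of words of length `k`, one
with maximal mean value of `A`, and then of minimal period, visits each word of length `k` at
most once. -/
theorem HasMemory.exists_maximal_cycle [Finite S] [Nonempty Y.carrier] {k : ℕ}
    (hk : HasMemory Y k) {A : Y.carrier → ℝ} (hA : IsLocal k A) :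
    ∃ (p : Y.carrier) (N : ℕ), 0 < N ∧ (sigma Y)^[N] p = p ∧
      (∀ i j, Agree k ((sigma Y)^[i] p) ((sigma Y)^[j] p) →
        (sigma Y)^[i] p = (sigma Y)^[j] p) ∧
      ∀ (q : Y.carrier) (n : ℕ), n ≤ Nat.card (Fin k → S) → (sigma Y)^[n] q = q →
        birkhoffSum (sigma Y) A n q ≤ n * (birkhoffSum (sigma Y) A N p / N) := by
  set W := Nat.card (Fin k → S) with hW
  let C : Set (Y.carrier × ℕ) := {q | 0 < q.2 ∧ q.2 ≤ W ∧ (sigma Y)^[q.2] q.1 = q.1}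
  let avg : Y.carrier × ℕ → ℝ := fun q => birkhoffSum (sigma Y) A q.2 q.1 / q.2
  have hCfin : C.Finite := by
    have hfin : (⋃ n ∈ Set.Icc 1 W,
        {p : Y.carrier | (sigma Y)^[n] p = p} ×ˢ ({n} : Set ℕ)).Finite :=
      (Set.finite_Icc 1 W).biUnion fun n hn => (finite_periodic hn.1).prod (Set.finite_singleton n)
    refine hfin.subset fun q hq => ?_
    simp only [Set.mem_iUnion]
    exact ⟨q.2, ⟨hq.1, hq.2.1⟩, hq.2.2, rfl⟩
  have hCne : C.Nonempty := by
    obtain ⟨x⟩ := ‹Nonempty Y.carrier›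
    obtain ⟨i, j, hij, hjW, hagree⟩ := exists_agree_iterate k x
    obtain ⟨p, hp, -⟩ := hk.exists_loop ((sigma Y)^[i] x) (N := j - i) (by omega) (by
      rw [← Function.iterate_add_apply, Nat.sub_add_cancel hij.le]
      exact hagree)
    exact ⟨(p, j - i), by simp only; omega, by simp only; omega, hp⟩
  obtain ⟨q₀, hq₀, hmax⟩ := Set.exists_max_image C avg hCfin hCne
  obtain ⟨⟨p, N⟩, ⟨hpC, hpavg⟩, hmin⟩ := Set.exists_min_image {q ∈ C | avg q = avg q₀} Prod.snd
    (hCfin.subset fun _ h => h.1) ⟨q₀, hq₀, rfl⟩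
  obtain ⟨hN, hNW, hp⟩ := hpC
  simp only at hN hNW hp
  have hmean : ∀ (q : Y.carrier) (n : ℕ), n ≤ W → (sigma Y)^[n] q = q →
      birkhoffSum (sigma Y) A n q ≤ n * (birkhoffSum (sigma Y) A N p / N) := by
    intro q n hn hq
    rcases Nat.eq_zero_or_pos n with rfl | hn0
    · simp
    · have h1 : avg (q, n) ≤ avg (p, N) := hpavg ▸ hmax (q, n) ⟨hn0, hn, hq⟩
      have h2 : (0 : ℝ) < n := by exact_mod_cast hn0
      have h3 := (div_le_iff₀ h2).1 h1
      simp only [avg] at h3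
      linarith
  refine ⟨p, N, hN, hp, ?_, hmean⟩
  -- A repeated `k`-word would split the cycle into two shorter loops `q` and `r` whose Birkhoff
  -- sums add up to that of `p`. Neither mean exceeds the maximum, and minimality of `N` makes that
  -- of `q` strictly smaller, so the total would be too small.
  have hdist : ∀ i j, i < j → j < N → ¬ Agree k ((sigma Y)^[i] p) ((sigma Y)^[j] p) := by
    intro i j hij hj h
    obtain ⟨q, hq, hqa⟩ := hk.exists_loop ((sigma Y)^[i] p) (N := j - i) (by omega) (by
      rw [← Function.iterate_add_apply, Nat.sub_add_cancel hij.le]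
      exact h)
    have hret : (sigma Y)^[N - (j - i)] ((sigma Y)^[j] p) = (sigma Y)^[i] p := by
      rw [← Function.iterate_add_apply, show N - (j - i) + j = i + N by omega,
        Function.iterate_add_apply, hp]
    obtain ⟨r, hr, hra⟩ := hk.exists_loop ((sigma Y)^[j] p) (N := N - (j - i)) (by omega) (by
      rw [hret]
      exact h.symm)
    have h1 := hA.birkhoffSum_eq hqa
    have h2 := hA.birkhoffSum_eq hra
    have h3 := birkhoffSum_add (sigma Y) A (j - i) (N - (j - i)) ((sigma Y)^[i] p)
    rw [← Function.iterate_add_apply, Nat.sub_add_cancel hij.le,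
      show j - i + (N - (j - i)) = N by omega, birkhoffSum_iterate_of_periodic hp, ← h1, ← h2]
      at h3
    have h4 := hmean r _ (by omega) hr
    have h5 : birkhoffSum (sigma Y) A (j - i) q <
        (j - i : ℕ) * (birkhoffSum (sigma Y) A N p / N) := by
      refine lt_of_le_of_ne (hmean q _ (by omega) hq) fun heq => ?_
      have hji : ((j - i : ℕ) : ℝ) ≠ 0 := by
        have : j - i ≠ 0 := by omega
        exact_mod_cast this
      have h6 := hmin (q, j - i) ⟨⟨by simp only; omega, by simp only; omega, hq⟩, by
        rw [← hpavg]
        simp only [avg]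
        rw [heq, mul_div_cancel_left₀ _ hji]⟩
      simp only at h6
      omega
    have hN' : (N : ℝ) ≠ 0 := by exact_mod_cast hN.ne'
    have h6 : ((j - i : ℕ) : ℝ) + ((N - (j - i) : ℕ) : ℝ) = N := by
      rw [← Nat.cast_add]
      congr 1
      omega
    have h7 : (N : ℝ) * (birkhoffSum (sigma Y) A N p / N) = birkhoffSum (sigma Y) A N p := by
      field_simp
    rw [← h6, add_mul] at h7
    rw [h6] at h7
    linarith
  intro i j h
  rw [← Function.IsPeriodicPt.iterate_mod_apply (f := sigma Y) hp i,
    ← Function.IsPeriodicPt.iterate_mod_apply (f := sigma Y) hp j] at h ⊢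
  rcases lt_trichotomy (i % N) (j % N) with hlt | heq | hgt
  · exact absurd h (hdist _ _ hlt (Nat.mod_lt _ hN))
  · rw [heq]
  · exact absurd h.symm (hdist _ _ hgt (Nat.mod_lt _ hN))

/-- If all short cycles have mean at most `m`, then all Birkhoff sums of length `n` are at most
`n m + O(1)`. -/
theorem HasMemory.exists_birkhoffSum_le [Finite S] {k : ℕ} (hk : HasMemory Y k)
    {A : Y.carrier → ℝ} (hA : IsLocal k A) {m : ℝ}
    (hm : ∀ (q : Y.carrier) (n : ℕ), n ≤ Nat.card (Fin k → S) → (sigma Y)^[n] q = q →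
        birkhoffSum (sigma Y) A n q ≤ n * m) :
    ∃ K, ∀ n x, birkhoffSum (sigma Y) A n x ≤ n * m + K := by
  obtain ⟨M, hM0, hM⟩ := hA.exists_bound
  set W := Nat.card (Fin k → S) with hW
  -- The constant only has to cover lengths below `W`; longer orbits lose a loop of mean at most `m`
  -- and are shortened.
  refine ⟨W * (M + |m|), fun n => ?_⟩
  induction n using Nat.strong_induction_on with
  | _ n ih =>
    intro x
    rcases lt_or_ge n W with hn | hn
    · have h1 := (le_abs_self _).trans (abs_birkhoffSum_le (sigma Y) hM n x)
      have h2 : (n : ℝ) ≤ W := by exact_mod_cast hn.le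
      have h3 : (n : ℝ) * (M + |m|) ≤ W * (M + |m|) :=
        mul_le_mul_of_nonneg_right h2 (by positivity)
      have h4 : (n : ℝ) * -|m| ≤ n * m :=
        mul_le_mul_of_nonneg_left (neg_abs_le m) n.cast_nonneg
      linarith
    · obtain ⟨i, j, hij, hjW, h⟩ := exists_agree_iterate k x
      obtain ⟨d, rfl⟩ : ∃ d, j = i + d := ⟨j - i, by omega⟩
      obtain ⟨r, rfl⟩ : ∃ r, n = i + d + r := ⟨n - (i + d), by omega⟩
      have h' : Agree k ((sigma Y)^[i] x) ((sigma Y)^[d] ((sigma Y)^[i] x)) := by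
        rw [← Function.iterate_add_apply, add_comm d i]
        exact h
      obtain ⟨p, hp, hpa⟩ := hk.exists_loop _ (by omega) h'
      obtain ⟨y, hya, hy⟩ := hk.exists_splice x i d h
      have h1 := hm p d (by omega) hp
      have h2 := ih (i + r) (by omega) y
      rw [birkhoffSum_add, hy, hA.birkhoffSum_eq hya] at h2
      rw [hA.birkhoffSum_eq hpa] at h1
      rw [birkhoffSum_add, birkhoffSum_add]
      rw [← Function.iterate_add_apply, add_comm d i] at *
      push_cast at *
      linarith

/-! ### Shadowing a periodic orbit -/

/-- `x` has the same first `k + 1` letters as some point of the orbit of `p`. -/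
def IsClose (k : ℕ) (p x : Y.carrier) : Prop := ∃ i, Agree (k + 1) x ((sigma Y)^[i] p)

/-- A point which stays close to an orbit with distinct `k`-words follows that orbit. -/
theorem exists_follow {k : ℕ} {p : Y.carrier}
    (hp : ∀ i j, Agree k ((sigma Y)^[i] p) ((sigma Y)^[j] p) →
      (sigma Y)^[i] p = (sigma Y)^[j] p) {x : Y.carrier} {L : ℕ}
    (hx : ∀ t < L, IsClose k p ((sigma Y)^[t] x)) :
    ∃ i, ∀ t < L, Agree (k + 1) ((sigma Y)^[t] x) ((sigma Y)^[t] ((sigma Y)^[i] p)) := by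
  induction L with
  | zero => exact ⟨0, fun t ht => absurd ht (by omega)⟩
  | succ L ih =>
    obtain ⟨i, hi⟩ := ih fun t ht => hx t (by omega)
    obtain ⟨j, hj⟩ := hx L (by omega)
    rcases Nat.eq_zero_or_pos L with rfl | hL
    · refine ⟨j, fun t ht => ?_⟩
      obtain rfl : t = 0 := by omega
      exact hj
    · refine ⟨i, fun t ht => ?_⟩
      rcases lt_or_ge t L with htL | htL
      · exact hi t htL
      obtain rfl : t = L := by omega
      -- Agreement on `k + 1` letters at time `t - 1` leaves `k` letters at time `t`. The orbit
      -- point close to the trajectory at time `t` shares them, so it is the expected one.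
      have h1 := hi (t - 1) (by omega)
      rw [add_comm] at h1
      have h2 := h1.iterate
      rw [← Function.iterate_add_apply, ← Function.iterate_add_apply,
        show 1 + (t - 1) = t by omega, ← Function.iterate_add_apply] at h2
      rw [← Function.iterate_add_apply, hp (t + i) j (h2.symm.trans (hj.mono (by omega)))]
      exact hj

theorem Agree.of_follow {x q : Y.carrier} {k L : ℕ}
    (h : ∀ t < L, Agree (k + 1) ((sigma Y)^[t] x) ((sigma Y)^[t] q)) : Agree L x q := by
  intro t ht
  have := h t ht 0 (by omega)
  rwa [sigma_iterate_apply, sigma_iterate_apply] at this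

/-- Each finite stretch follows some orbit point, a priori depending on the length. The first `k`
letters already determine that point, so a single one serves for every coordinate. -/
theorem eq_of_forall_isClose {k : ℕ} {p : Y.carrier}
    (hp : ∀ i j, Agree k ((sigma Y)^[i] p) ((sigma Y)^[j] p) →
      (sigma Y)^[i] p = (sigma Y)^[j] p) {x : Y.carrier}
    (hx : ∀ t, IsClose k p ((sigma Y)^[t] x)) : ∃ i, x = (sigma Y)^[i] p := by
  obtain ⟨i₀, hi₀⟩ := hx 0
  refine ⟨i₀, Subtype.ext (funext fun u => ?_)⟩
  obtain ⟨i, hi⟩ := exists_follow hp (L := u + k + 1) fun t _ => hx t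
  have ha := Agree.of_follow hi
  have h : (sigma Y)^[i] p = (sigma Y)^[i₀] p :=
    hp _ _ ((ha.mono (by omega)).symm.trans (Agree.mono (Nat.le_succ k) hi₀))
  rw [← h]
  exact ha u (by omega)

/-- Deviations of a small Hölder function from its mean on a periodic orbit. -/
theorem birkhoffSum_orbit_le {N : ℕ} {p : Y.carrier} (hN : 0 < N) (hpN : (sigma Y)^[N] p = p)
    {h : Y.carrier → ℝ} {η : ℝ} (hη : 0 ≤ η) (hh : ∀ x, |h x| ≤ η) (L i : ℕ) :
    birkhoffSum (sigma Y) h L ((sigma Y)^[i] p) ≤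
      L * (birkhoffSum (sigma Y) h N p / N) + 2 * N * η := by
  have hN' : (0 : ℝ) < N := by exact_mod_cast hN
  -- Full periods contribute exactly their mean. An incomplete one costs at most `N * η` for its sum
  -- and `N * η` for the mean it is compared with.
  have hmean : -η ≤ birkhoffSum (sigma Y) h N p / N := by
    rw [le_div_iff₀ hN']
    linarith [neg_abs_le (birkhoffSum (sigma Y) h N p), abs_birkhoffSum_le (sigma Y) hh N p]
  induction L using Nat.strong_induction_on generalizing i with
  | _ L ih =>
    rcases lt_or_ge L N with hL | hL
    · have h1 := (le_abs_self _).trans (abs_birkhoffSum_le (sigma Y) hh L ((sigma Y)^[i] p))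
      have h2 : (L : ℝ) ≤ N := by exact_mod_cast hL.le
      have h3 := mul_le_mul_of_nonneg_left hmean (Nat.cast_nonneg (α := ℝ) L)
      have h4 := mul_le_mul_of_nonneg_right h2 hη
      linarith
    · obtain ⟨r, rfl⟩ : ∃ r, L = N + r := ⟨L - N, by omega⟩
      have h1 := ih r (by omega) (N + i)
      rw [birkhoffSum_add, birkhoffSum_iterate_of_periodic hpN, ← Function.iterate_add_apply]
      have h2 : (N : ℝ) * (birkhoffSum (sigma Y) h N p / N) = birkhoffSum (sigma Y) h N p := by
        field_simp
      push_cast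
      linarith

open Classical in
/-- Deviations of a small Hölder function from its mean on a periodic orbit, in terms of the
number of times at which the orbit of `x` is not close to the periodic orbit. -/
theorem birkhoffSum_le_of_small {lam α : ℝ} (h0 : 0 < lam) (h1 : lam < 1) (hα : 0 < α) {k N : ℕ}
    {p : Y.carrier} (hN : 0 < N) (hpN : (sigma Y)^[N] p = p)
    (hp : ∀ i j, Agree k ((sigma Y)^[i] p) ((sigma Y)^[j] p) →
      (sigma Y)^[i] p = (sigma Y)^[j] p)
    {h : Y.carrier → ℝ} {η : ℝ} (hη : 0 ≤ η) (hh : ∀ x, |h x| ≤ η)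
    (hhold : ∀ x y, |h x - h y| ≤ η * symDist lam x y ^ α) (n : ℕ) (x : Y.carrier) :
    birkhoffSum (sigma Y) h n x ≤ n * (birkhoffSum (sigma Y) h N p / N) +
      η * ((1 - lam ^ α)⁻¹ + 2 * N + 2) *
        (birkhoffSum (sigma Y) (fun y => if IsClose k p y then 0 else 1) n x + 1) := by
  set m := birkhoffSum (sigma Y) h N p / N with hm
  set f : Y.carrier → ℝ := fun y => if IsClose k p y then 0 else 1 with hf
  set θ := lam ^ α with hθ
  have hθ0 : 0 < θ := Real.rpow_pos_of_pos h0 _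
  have hθ1 : θ < 1 := Real.rpow_lt_one h0.le h1 hα
  have hinv : 0 < (1 - θ)⁻¹ := inv_pos.2 (by linarith)
  have hN' : (0 : ℝ) < N := by exact_mod_cast hN
  have hmean : -η ≤ m := by
    rw [hm, le_div_iff₀ hN']
    linarith [neg_abs_le (birkhoffSum (sigma Y) h N p), abs_birkhoffSum_le (sigma Y) hh N p]
  have hf0 : ∀ n x, 0 ≤ birkhoffSum (sigma Y) f n x := fun n x =>
    Finset.sum_nonneg fun i _ => by
      simp only [hf]
      split_ifs <;> norm_num
  have hshadow : ∀ L y, (∀ t < L, IsClose k p ((sigma Y)^[t] y)) →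
      birkhoffSum (sigma Y) h L y ≤ L * m + η * ((1 - θ)⁻¹ + 2 * N) := by
    intro L y hy
    obtain ⟨i, hi⟩ := exists_follow hp hy
    have ha := Agree.of_follow hi
    have hdiff : birkhoffSum (sigma Y) h L y - birkhoffSum (sigma Y) h L ((sigma Y)^[i] p) ≤
        η * (1 - θ)⁻¹ := by
      unfold birkhoffSum
      rw [← Finset.sum_sub_distrib]
      have hterm : ∀ t ∈ Finset.range L,
          h ((sigma Y)^[t] y) - h ((sigma Y)^[t] ((sigma Y)^[i] p)) ≤ η * θ ^ (L - 1 - t) := by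
        intro t ht
        have ht' := Finset.mem_range.1 ht
        -- One letter of agreement is given up so that the exponents run over `0, …, L - 1` and the
        -- reflected sum is geometric.
        have hag : Agree (L - 1 - t) ((sigma Y)^[t] y) ((sigma Y)^[t] ((sigma Y)^[i] p)) :=
          Agree.iterate (ha.mono (by omega))
        refine (le_abs_self _).trans ((hhold _ _).trans (mul_le_mul_of_nonneg_left ?_ hη))
        calc symDist lam _ _ ^ α ≤ (lam ^ (L - 1 - t)) ^ α :=
              Real.rpow_le_rpow (symDist_nonneg h0 _ _) (symDist_le_of_agree h0 h1 hag) hα.le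
          _ = θ ^ (L - 1 - t) := by rw [hθ, Real.rpow_pow_comm h0.le]
      refine (Finset.sum_le_sum hterm).trans ?_
      rw [← Finset.mul_sum, Finset.sum_range_reflect (fun j => θ ^ j) L]
      refine mul_le_mul_of_nonneg_left ?_ hη
      rw [← tsum_geometric_of_lt_one hθ0.le hθ1]
      exact (summable_geometric_of_lt_one hθ0.le hθ1).sum_le_tsum _ fun j _ => by positivity
    have horb := birkhoffSum_orbit_le hN hpN hη hh L i
    linarith
  induction n using Nat.strong_induction_on generalizing x with
  | _ n ih =>
    by_cases hall : ∀ t < n, IsClose k p ((sigma Y)^[t] x)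
    · have h2 := hshadow n x hall
      have h3 : 0 ≤ η * ((1 - θ)⁻¹ + 2 * N + 2) * birkhoffSum (sigma Y) f n x :=
        mul_nonneg (by positivity) (hf0 n x)
      linarith
    · push Not at hall
      have hL := Nat.find_spec hall
      have hlt := fun t (ht : t < Nat.find hall) => Nat.find_min hall ht
      set L := Nat.find hall
      -- Cut at the first bad time `L`. The good stretch before it costs `η * ((1 - θ)⁻¹ + 2 * N)`.
      -- The bad step costs `η` for `h` and another `η` because `m ≥ -η`, hence the final `2` in the
      -- constant. The `+ 1` in the bound pays for the last good stretch.
      obtain ⟨r, hr⟩ : ∃ r, n = L + (1 + r) := ⟨n - L - 1, by omega⟩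
      have h2 := hshadow L x fun t ht => by
        by_contra hc
        exact hlt t ht ⟨by omega, hc⟩
      have h3 := ih r (by omega) ((sigma Y)^[1] ((sigma Y)^[L] x))
      have h4 : h ((sigma Y)^[L] x) ≤ η := (le_abs_self _).trans (hh _)
      have h5 : birkhoffSum (sigma Y) f n x =
          birkhoffSum (sigma Y) f L x + (1 +
            birkhoffSum (sigma Y) f r ((sigma Y)^[1] ((sigma Y)^[L] x))) := by
        rw [hr, birkhoffSum_add, birkhoffSum_add, birkhoffSum_one]
        simp only [hf, hL.2, if_false]
      have h6 : 0 ≤ η * ((1 - θ)⁻¹ + 2 * N + 2) * birkhoffSum (sigma Y) f L x :=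
        mul_nonneg (by positivity) (hf0 L x)
      rw [h5, hr, birkhoffSum_add, birkhoffSum_add, birkhoffSum_one]
      push_cast
      linarith

/-! ### Invariant measures -/

theorem continuous_sigma : Continuous (sigma Y) :=
  (continuous_shift (1 : ℕ)).restrict _

theorem isOpen_setOf_agree [DiscreteTopology S] (n : ℕ) (x : Y.carrier) :
    IsOpen {y : Y.carrier | Agree n x y} := by
  have : {y : Y.carrier | Agree n x y} = ⋂ i ∈ Set.Iio n, {y : Y.carrier | x.1 i = y.1 i} := by
    ext y
    simp [Agree]
  rw [this]
  refine (Set.finite_Iio n).isOpen_biInter fun i _ => ?_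
  exact (isOpen_discrete {s : S | x.1 i = s}).preimage
    ((continuous_apply i).comp continuous_subtype_val)

theorem continuous_of_holder [DiscreteTopology S] {lam α : ℝ} (h0 : 0 < lam) (h1 : lam < 1)
    (hα : 0 < α) {A : Y.carrier → ℝ} {C : ℝ}
    (hA : ∀ x y, |A x - A y| ≤ C * symDist lam x y ^ α) : Continuous A := by
  rw [continuous_iff_continuousAt]
  intro x
  rw [ContinuousAt, Metric.tendsto_nhds]
  intro ε hε
  have hlim : Tendsto (fun n : ℕ => |C| * (lam ^ α) ^ n) atTop (𝓝 (|C| * 0)) :=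
    (tendsto_pow_atTop_nhds_zero_of_lt_one (Real.rpow_nonneg h0.le _)
      (Real.rpow_lt_one h0.le h1 hα)).const_mul _
  rw [mul_zero] at hlim
  obtain ⟨n, hn⟩ := (hlim.eventually_lt_const hε).exists
  filter_upwards [(isOpen_setOf_agree n x).mem_nhds fun i _ => rfl] with y hy
  rw [Real.dist_eq]
  refine (hA y x).trans_lt (lt_of_le_of_lt ?_ hn)
  have h2 : symDist lam y x ^ α ≤ (lam ^ α) ^ n := by
    rw [Real.rpow_pow_comm h0.le]
    exact Real.rpow_le_rpow (symDist_nonneg h0 _ _)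
      (symDist_le_of_agree h0 h1 (Agree.symm hy)) hα.le
  exact mul_le_mul (le_abs_self C) h2 (Real.rpow_nonneg (symDist_nonneg h0 _ _) _) (abs_nonneg C)

theorem IsLocal.continuous [DiscreteTopology S] {k : ℕ} {A : Y.carrier → ℝ} (hA : IsLocal k A) :
    Continuous A := by
  rw [continuous_iff_continuousAt]
  intro x
  refine (continuousAt_const (y := A x)).congr ?_
  filter_upwards [(isOpen_setOf_agree (k + 1) x).mem_nhds fun i _ => rfl] with y hy
  exact hA x y hy

section Measure

variable [MeasurableSpace S]

theorem IsInvariantProb.integral_birkhoffSum {μ : Measure Y.carrier} (hμ : IsInvariantProb μ)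
    {g : Y.carrier → ℝ} (hg : Integrable g μ) (n : ℕ) :
    Integrable (birkhoffSum (sigma Y) g n) μ ∧
      ∫ x, birkhoffSum (sigma Y) g n x ∂μ = n * ∫ x, g x ∂μ := by
  have hpres := fun i : ℕ => hμ.2.iterate i
  have hint : ∀ i ∈ Finset.range n, Integrable (fun x => g ((sigma Y)^[i] x)) μ := fun i _ =>
    (hpres i).integrable_comp_of_integrable hg
  refine ⟨integrable_finsetSum _ hint, ?_⟩
  unfold birkhoffSum
  rw [integral_finsetSum _ hint]
  have : ∀ i ∈ Finset.range n, ∫ x, g ((sigma Y)^[i] x) ∂μ = ∫ x, g x ∂μ := fun i _ => by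
    have h := (hpres i).map_eq
    rw [← integral_map (hpres i).measurable.aemeasurable (by rw [h]; exact hg.aestronglyMeasurable),
      h]
  rw [Finset.sum_congr rfl this]
  simp

/-- A bound of Birkhoff sums that involves another Birkhoff sum passes to the integrals. -/
theorem IsInvariantProb.integral_le {μ : Measure Y.carrier} (hμ : IsInvariantProb μ)
    {g f : Y.carrier → ℝ} (hg : Integrable g μ) (hf : Integrable f μ) {β c K : ℝ}
    (h : ∀ n x, birkhoffSum (sigma Y) g n x ≤ n * β + K - c * birkhoffSum (sigma Y) f n x) :
    ∫ x, g x ∂μ ≤ β - c * ∫ x, f x ∂μ := by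
  have := hμ.1
  -- Integration turns Birkhoff sums into multiples of `n`, so a positive excess would grow past the
  -- fixed constant `K`.
  have hn : ∀ n : ℕ, n * (∫ x, g x ∂μ - (β - c * ∫ x, f x ∂μ)) ≤ K := by
    intro n
    obtain ⟨h1, h2⟩ := hμ.integral_birkhoffSum hg n
    obtain ⟨h3, h4⟩ := hμ.integral_birkhoffSum hf n
    have h5 := integral_mono h1 ((integrable_const (n * β + K)).sub (h3.const_mul c)) (h n)
    simp only [Pi.sub_apply] at h5
    rw [integral_sub (integrable_const _) (h3.const_mul c), integral_const_mul, h2, h4] at h5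
    simp only [integral_const, probReal_univ, one_smul] at h5
    linarith
  by_contra! hlt
  obtain ⟨n, hn'⟩ := exists_nat_gt (K / (∫ x, g x ∂μ - (β - c * ∫ x, f x ∂μ)))
  rw [div_lt_iff₀ (by linarith)] at hn'
  linarith [hn n]

section Orbit

variable {p : Y.carrier} {N : ℕ}

theorem orbitMeasure_apply {s : Set Y.carrier} (hs : MeasurableSet s) :
    orbitMeasure p N s =
      (N : ENNReal)⁻¹ * birkhoffSum (sigma Y) (s.indicator 1) N p := by
  simp [orbitMeasure, birkhoffSum, Measure.dirac_apply' _ hs]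

theorem isInvariantProb_orbitMeasure (hσ : Measurable (sigma Y)) (hN : 0 < N)
    (hp : (sigma Y)^[N] p = p) : IsInvariantProb (orbitMeasure p N) := by
  constructor
  · constructor
    rw [orbitMeasure_apply MeasurableSet.univ]
    simp only [birkhoffSum, Set.indicator_univ, Pi.one_apply, Finset.sum_const, Finset.card_range,
      nsmul_eq_mul, mul_one]
    exact ENNReal.inv_mul_cancel (by exact_mod_cast hN.ne') (ENNReal.natCast_ne_top N)
  · refine ⟨hσ, Measure.ext fun s hs => ?_⟩
    rw [Measure.map_apply hσ hs, orbitMeasure_apply hs, orbitMeasure_apply (hσ hs)]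
    congr 1
    -- Splitting off the first or the last term of the sum of length `N + 1` removes the same finite
    -- value, since `σ^N p = p`.
    have h1 := birkhoffSum_succ (sigma Y) (s.indicator (1 : Y.carrier → ENNReal)) N p
    rw [birkhoffSum_succ', hp, add_comm] at h1
    have hfin : s.indicator (1 : Y.carrier → ENNReal) p ≠ ⊤ := by
      by_cases h : p ∈ s <;> simp [h]
    rw [← (ENNReal.add_left_inj hfin).1 h1]
    refine Finset.sum_congr rfl fun i _ => ?_
    rw [← Function.iterate_succ_apply, Function.iterate_succ_apply']
    rfl

theorem integral_orbitMeasure {g : Y.carrier → ℝ} (hg : StronglyMeasurable g) :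
    ∫ x, g x ∂(orbitMeasure p N) = birkhoffSum (sigma Y) g N p / N := by
  unfold orbitMeasure
  rw [integral_smul_measure, integral_finsetSum_measure]
  · simp [integral_dirac' _ _ hg, birkhoffSum, div_eq_inv_mul]
  · intro i _
    exact ⟨hg.aestronglyMeasurable, by
      rw [hasFiniteIntegral_iff_enorm, lintegral_dirac' _ hg.enorm]
      exact enorm_lt_top⟩

/-- The only invariant probability measure carried by a periodic orbit. -/
theorem IsInvariantProb.eq_orbitMeasure (hσ : Measurable (sigma Y)) (hN : 0 < N)
    (hp : (sigma Y)^[N] p = p) {μ : Measure Y.carrier} (hμ : IsInvariantProb μ)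
    (hsupp : ∀ᵐ x ∂μ, ∃ i, x = (sigma Y)^[i] p) : μ = orbitMeasure p N := by
  have := hμ.1
  have := (isInvariantProb_orbitMeasure hσ hN hp).1
  refine Measure.ext fun s hs => ?_
  have hmeas : StronglyMeasurable (s.indicator (1 : Y.carrier → ℝ)) :=
    stronglyMeasurable_one.indicator hs
  have hint : Integrable (s.indicator (1 : Y.carrier → ℝ)) μ :=
    (integrable_const (1 : ℝ)).indicator hs
  have h1 := (hμ.integral_birkhoffSum hint N).2
  -- A Birkhoff sum over a full period is constant on the orbit, hence almost everywhere constant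
  -- for `μ`.
  have h2 : ∫ x, birkhoffSum (sigma Y) (s.indicator (1 : Y.carrier → ℝ)) N x ∂μ =
      birkhoffSum (sigma Y) (s.indicator (1 : Y.carrier → ℝ)) N p := by
    rw [integral_congr_ae (g := fun _ =>
      birkhoffSum (sigma Y) (s.indicator (1 : Y.carrier → ℝ)) N p)]
    · simp
    · filter_upwards [hsupp] with x ⟨i, hi⟩
      rw [hi, birkhoffSum_iterate_of_periodic hp]
  have h3 := integral_orbitMeasure (p := p) (N := N) hmeas
  have hN' : (N : ℝ) ≠ 0 := by exact_mod_cast hN.ne'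
  rw [← h2, h1, mul_div_cancel_left₀ _ hN', integral_indicator_one hs,
    integral_indicator_one hs] at h3
  exact ((ENNReal.toReal_eq_toReal_iff' (measure_ne_top _ s) (measure_ne_top _ s)).1 h3).symm

end Orbit

/-! ### Locking at a periodic orbit -/

/-- For a locally constant `A` and every `ε > 0`, the function `A - ε f`, where `f` is the
indicator function of the complement of a neighbourhood of a suitable periodic orbit, has this
orbit as its unique maximizing measure, and so have all nearby Hölder functions. -/
theorem HasMemory.exists_locking [Finite S] [DiscreteTopology S] [BorelSpace S]
    [Nonempty Y.carrier] {k : ℕ} (hk : HasMemory Y k) {A : Y.carrier → ℝ} (hA : IsLocal k A)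
    {lam α ε : ℝ} (h0 : 0 < lam) (h1 : lam < 1) (hα : 0 < α) (hε : 0 < ε) :
    ∃ (f : Y.carrier → ℝ) (p : Y.carrier) (N : ℕ) (η : ℝ), IsLocal k f ∧ (∀ x, |f x| ≤ 1) ∧
      0 < N ∧ (sigma Y)^[N] p = p ∧ 0 < η ∧
      ∀ (r : ℝ) (h : Y.carrier → ℝ), (∀ x, |h x| ≤ η) →
        (∀ x y, |h x - h y| ≤ η * symDist lam x y ^ α) → ∀ μ : Measure Y.carrier,
        IsMaximizing (fun x => A x - ε * f x + r + h x) μ ↔ μ = orbitMeasure p N := by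
  classical
  obtain ⟨p, N, hN, hpN, hp, hmean⟩ := hk.exists_maximal_cycle hA
  obtain ⟨K, hK⟩ := hk.exists_birkhoffSum_le hA hmean
  set f : Y.carrier → ℝ := fun y => if IsClose k p y then 0 else 1 with hf
  have hN' : (0 : ℝ) < N := by exact_mod_cast hN
  have hθ1 : lam ^ α < 1 := Real.rpow_lt_one h0.le h1 hα
  have hE : 0 < (1 - lam ^ α)⁻¹ + 2 * N + 2 := by
    have : 0 < (1 - lam ^ α)⁻¹ := inv_pos.2 (by linarith)
    positivity
  set E := (1 - lam ^ α)⁻¹ + 2 * N + 2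
  have hσ : Measurable (sigma Y) := continuous_sigma.measurable
  have hflocal : IsLocal k f := fun x y hxy => by
    have : IsClose k p x ↔ IsClose k p y :=
      ⟨fun ⟨i, hi⟩ => ⟨i, hxy.symm.trans hi⟩, fun ⟨i, hi⟩ => ⟨i, hxy.trans hi⟩⟩
    simp only [hf, this]
  have hf1 : ∀ x, |f x| ≤ 1 := fun x => by
    simp only [hf]
    split_ifs <;> simp
  have hf0 : ∀ x, 0 ≤ f x := fun x => by
    simp only [hf]
    split_ifs <;> simp
  have hforbit : birkhoffSum (sigma Y) f N p = 0 := Finset.sum_eq_zero fun i _ => by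
    have : IsClose k p ((sigma Y)^[i] p) := ⟨i, fun _ _ => rfl⟩
    simp only [hf, this, if_true]
  -- With this `η` one has `η * E = ε / 2`, so the perturbation uses up only half of the penalty `ε
  -- * f`.
  refine ⟨f, p, N, ε / (2 * E), hflocal, hf1, hN, hpN, by positivity, fun r h hh hhold => ?_⟩
  set B : Y.carrier → ℝ := fun x => A x - ε * f x + r + h x with hB
  have hBcont : Continuous B :=
    ((hA.continuous.sub (continuous_const.mul hflocal.continuous)).add continuous_const).add
      (continuous_of_holder h0 h1 hα hhold)
  have hBint : ∀ μ : Measure Y.carrier, IsInvariantProb μ → Integrable B μ := by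
    intro μ hμ
    have := hμ.1
    obtain ⟨M, -, hM⟩ := hA.exists_bound
    refine Integrable.of_bound hBcont.measurable.aestronglyMeasurable
      (M + ε + |r| + ε / (2 * E)) (Eventually.of_forall fun x => ?_)
    have h2 : |ε * f x| ≤ ε := by
      rw [abs_mul, abs_of_pos hε]
      exact mul_le_of_le_one_right hε.le (hf1 x)
    calc ‖B x‖ ≤ |A x - ε * f x + r| + |h x| := abs_add_le _ _
      _ ≤ |A x - ε * f x| + |r| + |h x| := by gcongr; exact abs_add_le _ _
      _ ≤ |A x| + |ε * f x| + |r| + |h x| := by gcongr; exact abs_sub _ _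
      _ ≤ M + ε + |r| + ε / (2 * E) := by gcongr; exacts [hM x, hh x]
  have hfint : ∀ μ : Measure Y.carrier, IsInvariantProb μ → Integrable f μ := by
    intro μ hμ
    have := hμ.1
    exact Integrable.of_bound hflocal.continuous.measurable.aestronglyMeasurable 1
      (Eventually.of_forall hf1)
  have hBsum : ∀ n x, birkhoffSum (sigma Y) B n x = birkhoffSum (sigma Y) A n x -
      ε * birkhoffSum (sigma Y) f n x + n * r + birkhoffSum (sigma Y) h n x := by
    intro n x
    simp [birkhoffSum, hB, Finset.sum_add_distrib, Finset.sum_sub_distrib, Finset.mul_sum]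
  set β := birkhoffSum (sigma Y) B N p / N with hβ
  have hβ' : β = birkhoffSum (sigma Y) A N p / N + r + birkhoffSum (sigma Y) h N p / N := by
    rw [hβ, hBsum, hforbit]
    field_simp
    ring
  have horb := isInvariantProb_orbitMeasure hσ hN hpN
  have horbint : ∫ x, B x ∂(orbitMeasure p N) = β :=
    integral_orbitMeasure hBcont.measurable.stronglyMeasurable
  have hle : ∀ μ : Measure Y.carrier, IsInvariantProb μ →
      ∫ x, B x ∂μ ≤ β - ε / 2 * ∫ x, f x ∂μ := by
    intro μ hμ
    refine hμ.integral_le (hBint μ hμ) (hfint μ hμ) (K := K + ε / 2) fun n x => ?_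
    have h2 := hK n x
    have h3 := birkhoffSum_le_of_small h0 h1 hα hN hpN hp (by positivity) hh hhold n x
    rw [show ε / (2 * E) * E = ε / 2 by field_simp] at h3
    rw [hBsum, hβ']
    linarith
  have hfnn : ∀ μ : Measure Y.carrier, 0 ≤ ∫ x, f x ∂μ := fun μ => integral_nonneg hf0
  intro μ
  constructor
  · rintro ⟨hμ, hmax⟩
    have := hμ.1
    have h2 := hmax _ horb
    rw [horbint] at h2
    have h3 : ∫ x, f x ∂μ = 0 := by
      have h4 := hle μ hμ
      have h5 : ε / 2 * ∫ x, f x ∂μ ≤ 0 := by linarith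
      exact le_antisymm (nonpos_of_mul_nonpos_right h5 (by positivity)) (hfnn μ)
    rw [integral_eq_zero_iff_of_nonneg hf0 (hfint μ hμ)] at h3
    -- Invariance transports `f = 0` almost everywhere to all iterates simultaneously.
    have h4 : ∀ᵐ x ∂μ, ∀ t : ℕ, IsClose k p ((sigma Y)^[t] x) := by
      rw [ae_all_iff]
      intro t
      filter_upwards [(hμ.2.iterate t).quasiMeasurePreserving.ae h3] with x hx
      by_contra hc
      simp [hf, hc] at hx
    refine hμ.eq_orbitMeasure hσ hN hpN ?_
    filter_upwards [h4] with x hx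
    exact eq_of_forall_isClose hp hx
  · rintro rfl
    refine ⟨horb, fun ν hν => ?_⟩
    have h2 := hle ν hν
    have h3 : 0 ≤ ε / 2 * ∫ x, f x ∂ν := mul_nonneg (by positivity) (hfnn ν)
    linarith

end Measure

/-! ### Pressure -/

theorem partitionSup_le {lam c : ℝ} {A B : Y.carrier → ℝ} (h : ∀ x, B x ≤ c + A x) (n : ℕ)
    (ε : ℝ) :
    partitionSup lam B n ε ≤ ENNReal.ofReal (Real.exp (n * c)) * partitionSup lam A n ε := by
  refine iSup₂_le fun E hE => ?_
  refine le_trans ?_ (mul_le_mul_right (le_iSup₂ (f := fun (E : Finset Y.carrier)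
    (_ : IsSeparated lam n ε E) =>
      ∑ x ∈ E, ENNReal.ofReal (Real.exp (birkhoffSum (sigma Y) A n x))) E hE) _)
  rw [Finset.mul_sum]
  refine Finset.sum_le_sum fun x _ => ?_
  rw [← ENNReal.ofReal_mul (Real.exp_nonneg _), ← Real.exp_add]
  refine ENNReal.ofReal_le_ofReal (Real.exp_le_exp.2 ?_)
  refine (Finset.sum_le_sum fun i _ => h _).trans_eq ?_
  simp [birkhoffSum, Finset.sum_add_distrib]

/-- Birkhoff sums compare with an error `n * c`, which becomes `c` after taking logarithms and
dividing by `n`. This one-sided form yields both the Lipschitz bound and the behaviour under adding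
constants. -/
theorem pressure_le {lam c : ℝ} {A B : Y.carrier → ℝ} (h : ∀ x, B x ≤ c + A x) :
    pressure lam B ≤ c + pressure lam A := by
  refine iSup₂_le fun ε hε => ?_
  refine le_trans ?_ (add_le_add_right (le_iSup₂ (f := fun (ε : ℝ) (_ : 0 < ε) =>
    limsup (fun n : ℕ => ENNReal.log (partitionSup lam A n ε) / (n : EReal)) atTop) ε hε) _)
  have hconst : limsup (fun _ : ℕ => (c : EReal)) atTop = c := limsup_const _
  calc limsup (fun n : ℕ => ENNReal.log (partitionSup lam B n ε) / (n : EReal)) atTop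
      ≤ limsup ((fun _ : ℕ => (c : EReal)) +
          fun n : ℕ => ENNReal.log (partitionSup lam A n ε) / (n : EReal)) atTop := by
        refine limsup_le_limsup ?_
        filter_upwards [eventually_gt_atTop 0] with n hn
        have hn' : (0 : ℝ) < n := by exact_mod_cast hn
        have hdiv : ((n * c : ℝ) : EReal) / (n : EReal) = c := by
          rw [← EReal.coe_natCast, ← EReal.coe_div]
          congr 1
          field_simp
        have h1 := EReal.div_le_div_right_of_nonneg (c := (n : EReal)) n.cast_nonneg'
          (ENNReal.log_le_log (partitionSup_le (lam := lam) h n ε))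
        rwa [ENNReal.log_mul_add, ENNReal.log_ofReal_of_pos (Real.exp_pos _), Real.log_exp,
          EReal.add_div_of_nonneg_right n.cast_nonneg', hdiv] at h1
    _ ≤ _ := by
        refine (EReal.limsup_add_le (.inl ?_) (.inl ?_)).trans_eq (by rw [hconst])
        · rw [hconst]; exact EReal.coe_ne_bot c
        · rw [hconst]; exact EReal.coe_ne_top c

/-- A function near a function of zero pressure is made to have zero pressure by subtracting a
small constant. -/
theorem exists_pressure_sub_eq_zero {lam δ : ℝ} {A B : Y.carrier → ℝ} (hA : pressure lam A = 0)
    (h : ∀ x, |B x - A x| ≤ δ) : ∃ r, |r| ≤ δ ∧ pressure lam (fun x => B x - r) = 0 := by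
  have h1 : pressure lam B ≤ (δ : EReal) := by
    simpa [hA] using pressure_le (lam := lam) (c := δ) (A := A) (B := B) fun x => by
      linarith [(abs_le.1 (h x)).2]
  have h2 : (-δ : ℝ) ≤ pressure lam B := by
    have h3 := pressure_le (lam := lam) (c := δ) (A := B) (B := A) fun x => by
      linarith [(abs_le.1 (h x)).1]
    rw [hA] at h3
    have h4 := add_le_add_right h3 ((-δ : ℝ) : EReal)
    rwa [add_zero, ← add_assoc, ← EReal.coe_add, neg_add_cancel, EReal.coe_zero, zero_add] at h4
  -- The pressure of `B` lies between `-δ` and `δ`, hence is finite, and its value is the constant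
  -- to subtract.
  obtain ⟨r, hr⟩ : ∃ r : ℝ, pressure lam B = r :=
    ⟨(pressure lam B).toReal, (EReal.coe_toReal
      (h1.trans_lt (EReal.coe_lt_top δ)).ne ((EReal.bot_lt_coe (-δ)).trans_le h2).ne').symm⟩
  rw [hr, EReal.coe_le_coe_iff] at h1 h2
  refine ⟨r, abs_le.2 ⟨h2, h1⟩, le_antisymm ?_ ?_⟩
  · refine (pressure_le (c := -r) (A := B) fun x => by linarith).trans_eq ?_
    rw [hr, ← EReal.coe_add, neg_add_cancel, EReal.coe_zero]
  · have h3 := pressure_le (lam := lam) (c := r) (A := fun x => B x - r) (B := B) fun x => by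
      linarith
    rw [hr] at h3
    have h4 := add_le_add_right h3 ((-r : ℝ) : EReal)
    rwa [← add_assoc, ← EReal.coe_add, neg_add_cancel, EReal.coe_zero, zero_add] at h4

/-- On an empty space `A ≤ -1 + A` holds vacuously, and zero pressure would give `0 ≤ -1`. -/
theorem nonempty_of_pressure_eq_zero {lam : ℝ} {A : Y.carrier → ℝ} (hA : pressure lam A = 0) :
    Nonempty Y.carrier := by
  by_contra hne
  rw [not_nonempty_iff] at hne
  have h := pressure_le (lam := lam) (c := -1) (A := A) (B := A) fun x => hne.elim x
  rw [hA, add_zero, ← EReal.coe_zero, EReal.coe_le_coe_iff] at h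
  linarith

/-! ### Approximation by locally constant functions -/

theorem HolderSpace.norm_le {lam α C M : ℝ} (hC : 0 ≤ C) (hM : 0 ≤ M) (A : HolderSpace Y lam α)
    (h : ∀ x, |A x| ≤ M) (h' : ∀ x y, |A x - A y| ≤ C * symDist lam x y ^ α) : ‖A‖ ≤ C + M :=
  add_le_add
    (Real.iSup_le (fun p => (div_le_iff₀ (Real.rpow_pos_of_pos p.2.1 α)).2 (h' _ _)) hC)
    (Real.iSup_le h hM)

theorem HolderSpace.abs_apply_le_norm {lam α : ℝ} (A : HolderSpace Y lam α) (x : Y.carrier) :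
    |A x| ≤ ‖A‖ :=
  (le_ciSup (bddAbove_abs A) x).trans (le_add_of_nonneg_left (holdConst_nonneg lam α _))

theorem HolderSpace.abs_sub_le_norm {lam α : ℝ} (h0 : 0 < lam) (h1 : lam < 1)
    (A : HolderSpace Y lam α) (x y : Y.carrier) :
    |A x - A y| ≤ ‖A‖ * symDist lam x y ^ α := by
  rcases eq_or_ne x y with rfl | hxy
  · rw [sub_self, abs_zero]
    exact mul_nonneg (norm_nonneg _) (Real.rpow_nonneg (symDist_nonneg h0 _ _) _)
  · have hpos : 0 < symDist lam x y := by
      unfold symDist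
      rw [if_neg hxy]
      positivity
    rw [← div_le_iff₀ (Real.rpow_pos_of_pos hpos α)]
    exact (le_ciSup (bddAbove_hold A) ⟨(x, y), hpos, symDist_le_one h0 h1 x y⟩).trans
      (le_add_of_nonneg_right (supNorm_nonneg _))

/-- Points with different values are at distance at least `lam ^ k`. Since `γ ≥ 0` is arbitrary,
bounded local functions belong to every Hölder class. -/
theorem IsLocal.abs_sub_le {lam γ : ℝ} (h0 : 0 < lam) (h1 : lam < 1) (hγ : 0 ≤ γ) {k : ℕ}
    {A : Y.carrier → ℝ} (hA : IsLocal k A) {M : ℝ} (hM : ∀ x, |A x| ≤ M) (x y : Y.carrier) :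
    |A x - A y| ≤ 2 * M / (lam ^ k) ^ γ * symDist lam x y ^ γ := by
  have hM0 : 0 ≤ M := (abs_nonneg _).trans (hM x)
  have hpos : 0 < (lam ^ k) ^ γ := Real.rpow_pos_of_pos (pow_pos h0 k) γ
  by_cases h : Agree (k + 1) x y
  · rw [hA x y h, sub_self, abs_zero]
    exact mul_nonneg (by positivity) (Real.rpow_nonneg (symDist_nonneg h0 _ _) _)
  · have h2 : (lam ^ k) ^ γ ≤ symDist lam x y ^ γ :=
      Real.rpow_le_rpow (pow_pos h0 k).le (le_symDist_of_not_agree h0 h1 h) hγ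
    calc |A x - A y| ≤ |A x| + |A y| := abs_sub _ _
      _ ≤ 2 * M := by linarith [hM x, hM y]
      _ = 2 * M / (lam ^ k) ^ γ * (lam ^ k) ^ γ := by field_simp
      _ ≤ _ := mul_le_mul_of_nonneg_left h2 (by positivity)

/-- Hölder functions of exponent `γ > α` are approximated by locally constant functions in the
`α`-Hölder norm. -/
theorem exists_isLocal_approx [Nonempty Y.carrier] {lam α γ : ℝ} (h0 : 0 < lam) (h1 : lam < 1)
    (hα : 0 < α) (hγ : α < γ) {A : Y.carrier → ℝ} (hA : A ∈ holderSubmodule Y lam γ) {δ : ℝ}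
    (hδ : 0 < δ) (k₀ : ℕ) :
    ∃ k ≥ k₀, ∃ B : Y.carrier → ℝ, IsLocal k B ∧ (∀ x, |B x - A x| ≤ δ) ∧
      ∀ x y, |(B x - A x) - (B y - A y)| ≤ δ * symDist lam x y ^ α := by
  obtain ⟨-, C', hC'⟩ := hA
  set C := |C'|
  have hd := fun x y : Y.carrier => symDist_nonneg h0 x y
  have hC : ∀ x y, |A x - A y| ≤ C * symDist lam x y ^ γ := fun x y =>
    (hC' x y).trans (mul_le_mul_of_nonneg_right (le_abs_self C') (Real.rpow_nonneg (hd x y) _))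
  have hC0 : 0 ≤ C := abs_nonneg C'
  have hlim : Tendsto (fun n : ℕ => 2 * C * (lam ^ (γ - α)) ^ n) atTop (𝓝 (2 * C * 0)) :=
    (tendsto_pow_atTop_nhds_zero_of_lt_one (Real.rpow_nonneg h0.le _)
      (Real.rpow_lt_one h0.le h1 (by linarith))).const_mul _
  rw [mul_zero] at hlim
  obtain ⟨k, hkδ, hk⟩ := ((hlim.eventually_lt_const hδ).and (eventually_ge_atTop k₀)).exists
  set τ := (lam ^ k) ^ (γ - α) with hτ
  rw [Real.rpow_pow_comm h0.le] at hkδ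
  have hk0 : 0 < lam ^ k := pow_pos h0 k
  have hk1 : lam ^ k ≤ 1 := pow_le_one₀ h0.le h1.le
  have hτ0 : 0 < τ := Real.rpow_pos_of_pos hk0 _
  have hτα : (lam ^ k) ^ γ = τ * (lam ^ k) ^ α := by
    rw [hτ, ← Real.rpow_add hk0, sub_add_cancel]
  let w : Y.carrier → (Fin (k + 1) → S) := fun x i => x.1 i
  -- `ρ` selects one point in each cylinder of length `k + 1`, and the approximation is `A ∘ ρ`.
  let ρ : Y.carrier → Y.carrier := fun x => Function.invFun w (w x)
  have hρ : ∀ x, Agree (k + 1) (ρ x) x := fun x i hi =>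
    congrFun (Function.invFun_eq (f := w) ⟨x, rfl⟩) ⟨i, hi⟩
  have hloc : ∀ x y, Agree (k + 1) x y → ρ x = ρ y := fun x y h => by
    have : w x = w y := funext fun i => h i i.2
    simp only [ρ, this]
  have hsup : ∀ x, |A (ρ x) - A x| ≤ C * (τ * (lam ^ k) ^ α) := by
    intro x
    rw [← hτα]
    refine (hC _ _).trans (mul_le_mul_of_nonneg_left ?_ hC0)
    exact Real.rpow_le_rpow (hd _ _) (symDist_le_of_agree h0 h1 ((hρ x).mono (Nat.le_succ k)))
      (by linarith)
  refine ⟨k, hk, fun x => A (ρ x), fun x y h => by simp only [hloc x y h], fun x => ?_,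
    fun x y => ?_⟩
  · have h2 : (lam ^ k) ^ α ≤ 1 := Real.rpow_le_one hk0.le hk1 hα.le
    have h3 : C * (τ * (lam ^ k) ^ α) ≤ C * (τ * 1) := by gcongr
    have h4 : 0 ≤ C * τ := by positivity
    linarith [hsup x]
  · have hdα : 0 ≤ symDist lam x y ^ α := Real.rpow_nonneg (hd x y) _
    refine le_trans ?_ (mul_le_mul_of_nonneg_right hkδ.le hdα)
    -- Inside a cylinder only `A` varies, and the surplus exponent `γ - α` supplies the factor `τ`.
    -- In different cylinders the distance is at least `lam ^ k`, so the supremum bound suffices.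
    by_cases h : Agree (k + 1) x y
    · simp only [hloc x y h]
      rw [show A (ρ y) - A x - (A (ρ y) - A y) = -(A x - A y) by ring, abs_neg]
      rcases eq_or_ne x y with rfl | hxy
      · rw [sub_self, abs_zero]
        positivity
      have hpos : 0 < symDist lam x y := by
        unfold symDist
        rw [if_neg hxy]
        positivity
      have h2 : symDist lam x y ^ γ = symDist lam x y ^ (γ - α) * symDist lam x y ^ α := by
        rw [← Real.rpow_add hpos, sub_add_cancel]
      have h3 : symDist lam x y ^ (γ - α) ≤ τ := Real.rpow_le_rpow (hd _ _)
        (symDist_le_of_agree h0 h1 (h.mono (Nat.le_succ k))) (by linarith)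
      calc |A x - A y| ≤ C * (symDist lam x y ^ (γ - α) * symDist lam x y ^ α) := h2 ▸ hC x y
        _ ≤ C * (τ * symDist lam x y ^ α) := by gcongr
        _ ≤ 2 * C * τ * symDist lam x y ^ α := by
          have : 0 ≤ C * (τ * symDist lam x y ^ α) := by positivity
          linarith
    · have h2 : (lam ^ k) ^ α ≤ symDist lam x y ^ α :=
        Real.rpow_le_rpow hk0.le (le_symDist_of_not_agree h0 h1 h) hα.le
      calc _ ≤ |A (ρ x) - A x| + |A (ρ y) - A y| := abs_sub _ _
        _ ≤ 2 * C * τ * (lam ^ k) ^ α := by linarith [hsup x, hsup y]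
        _ ≤ _ := mul_le_mul_of_nonneg_left h2 (by positivity)

/-! ### Openness and density -/

variable [MeasurableSpace S]

theorem isOpen_periodicLocked (Y : Subshift S ℕ) (lam α : ℝ) :
    IsOpen (periodicLocked Y lam α) := by
  rw [isOpen_iff_mem_nhds]
  rintro A ⟨p, N, hN, hp, U, hU, h⟩
  obtain ⟨V, hVU, hV, hAV⟩ := mem_nhds_iff.1 hU
  filter_upwards [hV.mem_nhds hAV] with B hB
  exact ⟨p, N, hN, hp, V, hV.mem_nhds hB, fun D hD => h D (hVU hD)⟩

theorem dense_periodicLocked [Finite S] [Inhabited S] [DiscreteTopology S] [BorelSpace S]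
    (hY : IsFiniteType Y) {lam α : ℝ} (h0 : 0 < lam) (h1 : lam < 1) (hα : 0 < α) :
    Dense (periodicLocked Y lam α) := by
  intro A
  rw [Metric.mem_closure_iff]
  intro e he
  obtain ⟨A₁, ⟨γ, hγ, hA₁γ, hA₁P⟩, hAA₁⟩ := Metric.mem_closure_iff.1 A.2 (e / 2) (by linarith)
  have := nonempty_of_pressure_eq_zero hA₁P
  obtain ⟨k₀, hk₀⟩ := hY.exists_hasMemory
  obtain ⟨k, hk, A₂, hA₂, hsup₂, hhold₂⟩ :=
    exists_isLocal_approx h0 h1 hα hγ hA₁γ (δ := e / 16) (by linarith) k₀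
  have hc : 0 < (lam ^ k) ^ α := Real.rpow_pos_of_pos (pow_pos h0 k) α
  -- `2 * 1 / (lam ^ k) ^ α` bounds the Hölder constant of a local function bounded by `1`, so `ε *
  -- f` has `α`-norm at most `e / 16`.
  set ε := e / 16 / (1 + 2 * 1 / (lam ^ k) ^ α) with hε
  have hε0 : 0 < ε := by positivity
  have hεe : ε * (1 + 2 * 1 / (lam ^ k) ^ α) = e / 16 := by
    rw [hε, div_mul_cancel₀]
    positivity
  have hεc : 0 < ε * (2 * 1 / (lam ^ k) ^ α) := by positivity
  obtain ⟨f, p, N, η, hf, hf1, hN, hpN, hη, hlock⟩ :=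
    (hk₀ k hk).exists_locking hA₂ h0 h1 hα hε0
  have hsup₃ : ∀ x, |A₂ x - ε * f x - A₁ x| ≤ e / 8 := by
    intro x
    have h2 : |ε * f x| ≤ ε := by
      rw [abs_mul, abs_of_pos hε0]
      exact mul_le_of_le_one_right hε0.le (hf1 x)
    rw [sub_right_comm]
    linarith [abs_sub (A₂ x - A₁ x) (ε * f x), hsup₂ x]
  obtain ⟨r, hr, hP⟩ := exists_pressure_sub_eq_zero (B := fun x => A₂ x - ε * f x) hA₁P hsup₃
  set A₄ : Y.carrier → ℝ := fun x => A₂ x - ε * f x - r with hA₄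
  have hA₄loc : IsLocal k A₄ := fun x y h => by simp only [hA₄, hA₂ x y h, hf x y h]
  obtain ⟨M, -, hM⟩ := hA₄loc.exists_bound
  have hmem : ∀ γ', 0 ≤ γ' → A₄ ∈ holderSubmodule Y lam γ' := fun γ' hγ' =>
    ⟨⟨M, hM⟩, ⟨_, hA₄loc.abs_sub_le h0 h1 hγ' hM⟩⟩
  let D : HolderSpace Y lam α := ⟨A₄, hmem α hα.le⟩
  have hD : D ∈ holderPlusZero Y lam α :=
    subset_closure ⟨γ, hγ, hmem γ (hα.le.trans hγ.le), hP⟩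
  -- The Hölder part is `e / 16` each from the approximation and the penalty, as constants do not
  -- count. The supremum part is `e / 8` for those two together and `e / 8` for `r`.
  have hA₁D : ‖D - A₁‖ ≤ e / 8 + e / 4 := by
    refine HolderSpace.norm_le (by linarith) (by linarith) (D - A₁) (fun x => ?_) fun x y => ?_
    · change |A₂ x - ε * f x - r - A₁ x| ≤ _
      rw [sub_right_comm]
      linarith [abs_sub (A₂ x - ε * f x - A₁ x) r, hsup₃ x]
    · change |A₂ x - ε * f x - r - A₁ x - (A₂ y - ε * f y - r - A₁ y)| ≤ _
      have h2 := hf.abs_sub_le h0 h1 hα.le hf1 x y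
      have h3 := hhold₂ x y
      have hdα : 0 ≤ symDist lam x y ^ α := Real.rpow_nonneg (symDist_nonneg h0 _ _) _
      have h4 : |ε * (f x - f y)| ≤ e / 16 * symDist lam x y ^ α := by
        rw [abs_mul, abs_of_pos hε0]
        calc ε * |f x - f y| ≤ ε * (2 * 1 / (lam ^ k) ^ α * symDist lam x y ^ α) := by gcongr
          _ = ε * (2 * 1 / (lam ^ k) ^ α) * symDist lam x y ^ α := by ring
          _ ≤ e / 16 * symDist lam x y ^ α := by
            refine mul_le_mul_of_nonneg_right ?_ hdα
            linarith
      rw [show A₂ x - ε * f x - r - A₁ x - (A₂ y - ε * f y - r - A₁ y) =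
        (A₂ x - A₁ x - (A₂ y - A₁ y)) - ε * (f x - f y) by ring]
      linarith [abs_sub (A₂ x - A₁ x - (A₂ y - A₁ y)) (ε * (f x - f y))]
  refine ⟨⟨D, hD⟩, ⟨p, N, hN, hpN, Metric.ball ⟨D, hD⟩ η, Metric.ball_mem_nhds _ hη, ?_⟩, ?_⟩
  · intro B hB μ
    have hBD : ‖B.1 - D‖ ≤ η := by
      rw [← dist_eq_norm]
      exact (Metric.mem_ball.1 hB).le
    have h2 := hlock (-r) (B.1 - D : HolderSpace Y lam α)
      (fun x => (HolderSpace.abs_apply_le_norm _ x).trans hBD)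
      (fun x y => (HolderSpace.abs_sub_le_norm h0 h1 _ x y).trans
        (mul_le_mul_of_nonneg_right hBD (Real.rpow_nonneg (symDist_nonneg h0 _ _) _))) μ
    have h3 : (B.1 : Y.carrier → ℝ) =
        fun x => A₂ x - ε * f x + -r + (B.1 - D : HolderSpace Y lam α) x := by
      funext x
      change B.1 x = A₂ x - ε * f x + -r + (B.1 x - (A₂ x - ε * f x - r))
      ring
    rw [h3]
    exact h2
  · change dist A.1 D < e
    have h2 : dist A₁ D ≤ e / 8 + e / 4 := by
      rw [dist_comm, dist_eq_norm]
      exact hA₁D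
    linarith [dist_triangle A.1 A₁ D]

end HolderShift

end

theorem theoremB {S : Type*} [Finite S] [Inhabited S] [TopologicalSpace S] [DiscreteTopology S]
    [MeasurableSpace S] [BorelSpace S]
    (Y : Subshift S ℕ) (hY : HolderShift.IsFiniteType Y)
    (hmix : HolderShift.TopologicallyMixing (HolderShift.sigma Y))
    (lam : ℝ) (hlam0 : 0 < lam) (hlam1 : lam < 1) (α : ℝ) (hα0 : 0 < α) (hα1 : α ≤ 1) :
    IsOpen (HolderShift.periodicLocked Y lam α) ∧
      Dense (HolderShift.periodicLocked Y lam α) :=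
  ⟨HolderShift.isOpen_periodicLocked Y lam α,
    HolderShift.dense_periodicLocked hY hlam0 hlam1 hα0⟩
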